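/- Let $V$ be a finite-dimensional real vector space with complexification $V_{\mathbb C}=\mathbb C\otimes_{\mathbb R}V$. A linear map $T\in\mathfrak{gl}(V)$ is called *semisimple* if its complexification $T_{\mathbb C}$ is diagonalizable on $V_{\mathbb C}$; it is called *elliptic* (respectively *hyperbolic*) if it is semisimple and all eigenvalues of $T_{\mathbb C}$ are purely imaginary, $0$ included (respectively real); and it is called *nilpotent* if $T^n=0$ for some $n\in\mathbb N$. An *additive Jordan decomposition* of $X\in\mathfrak{gl}(V)$ is an expression $X=E+H+N$ with pairwise commuting $E,H,N\in\mathfrak{gl}(V)$ such that $E$ is elliptic, $H$ is hyperbolic and $N$ is nilpotent. **Theorem.** Let $\mathfrak g\subset\mathfrak{gl}(V)$ be a semisimple real Lie subalgebra (that is, the solvable radical of $\mathfrak g$ is zero) and let $X\in\mathfrak g$. Then $X$ has exactly one additive Jordan decomposition $X=E+H+N$, and its components (the elliptic, hyperbolic and nilpotent additive Jordan components of $X$) all lie in $\mathfrak g$: $E,H,N\in\mathfrak g$. -/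

import Mathlib

open scoped TensorProduct

attribute [local instance 100] LieRing.ofAssociativeRing

/-- The complexification `V_ℂ → V_ℂ`, `u + i v ↦ T u + i T v`, of a real linear map `T : V → V`,
where `V_ℂ = ℂ ⊗[ℝ] V`. -/
noncomputable def complexify {V : Type*} [AddCommGroup V] [Module ℝ V] (T : Module.End ℝ V) :
    Module.End ℂ (ℂ ⊗[ℝ] V) :=
  LinearMap.baseChange ℂ T

/-- A real linear map is semisimple if it is diagonalizable over `ℂ`: the eigenspaces of its
complexification span `V_ℂ`. -/
def IsSemisimpleMap {V : Type*} [AddCommGroup V] [Module ℝ V] (T : Module.End ℝ V) : Prop :=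
  ⨆ μ : ℂ, (complexify T).eigenspace μ = ⊤

/-- Elliptic in the additive sense: semisimple, and all complex eigenvalues are purely imaginary
(`0` is allowed). -/
def IsAddElliptic {V : Type*} [AddCommGroup V] [Module ℝ V] (T : Module.End ℝ V) : Prop :=
  IsSemisimpleMap T ∧ ∀ μ : ℂ, (complexify T).HasEigenvalue μ → μ.re = 0

/-- Hyperbolic in the additive sense: semisimple, and all complex eigenvalues are real. -/
def IsAddHyperbolic {V : Type*} [AddCommGroup V] [Module ℝ V] (T : Module.End ℝ V) : Prop :=
  IsSemisimpleMap T ∧ ∀ μ : ℂ, (complexify T).HasEigenvalue μ → μ.im = 0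

/-- `X = E + H + N` is an additive Jordan decomposition of `X`: the three maps commute pairwise,
`E` is elliptic, `H` is hyperbolic and `N` is nilpotent. -/
structure IsAddJordanDecomposition {V : Type*} [AddCommGroup V] [Module ℝ V]
    (X E H N : Module.End ℝ V) : Prop where
  eq_add : X = E + H + N
  commute_EH : Commute E H
  commute_EN : Commute E N
  commute_HN : Commute H N
  elliptic : IsAddElliptic E
  hyperbolic : IsAddHyperbolic H
  nilpotent : IsNilpotent N

/-!
# Additive Jordan components in a semisimple Lie algebra of endomorphisms

An additive Jordan decomposition `X = E + H + N` refines the Jordan–Chevalley decomposition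
`X = S + N`: after complexification `S = E + H` is diagonalizable, and `H` (respectively `E`) arises
from `S` by replacing each eigenvalue by its real part (respectively by `i` times its imaginary
part). Thus `H` is determined by `S`, which gives uniqueness, and it is a real polynomial in `S`,
which gives existence.

The components lie in `g` for the following reason, and Weyl's theorem on complete reducibility is
not needed. Let `L = ℂ ⊗ g`, whose Killing form is non-degenerate, act on `M = ℂ ⊗ V`. The
semisimple part of `ad X` is a derivation, hence inner, so that `X = s + n` in `L` with `ad s`
semisimple and `ad n` nilpotent (`LieAlgebra.IsKilling.exists_isSemisimple_ad_isNilpotent_ad`).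
Then `n` acts nilpotently on `M`, by a trace argument on its generalized eigenspaces, which are
submodules (`LieAlgebra.IsKilling.isNilpotent_toEnd_of_isNilpotent_ad`). The element `s` lies in a
Cartan subalgebra (`LieAlgebra.exists_isCartanSubalgebra_mem_of_isSemisimple_ad`), which is spanned
by coroots. Each coroot is the element `h` of an `sl₂` triple, so it acts diagonalizably with
integer eigenvalues (`LieAlgebra.IsKilling.iSup_iInf_eigenspace_coroot_eq_top`). Consequently `s`
acts diagonalizably, and `s` and `n` act as the Jordan–Chevalley parts of `X`.

Moreover, if `s = ∑ c α • coroot α` and `φ : ℂ → ℂ` is additive, then `∑ φ (c α) • coroot α` acts by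
applying `φ` to the eigenvalues of `s`, because
`φ (∑ c α * m α) = ∑ φ (c α) * m α` for integers `m α`
(`LieAlgebra.IsKilling.exists_iSup_eigenspace_inf_eigenspace_eq_top`). For `φ` the real part this
puts the complexification of `H` in the image of `L`, and taking real parts of coefficients descends
to `g` (`mem_of_toEnd_eq_complexify`).

Throughout, "`s` is diagonalizable and `u` is `φ` applied to `s`" is written
`⨆ μ, s.eigenspace μ ⊓ u.eigenspace (φ μ) = ⊤`.
-/

/-! ### Representations of `sl₂` -/

namespace IsSl2Triple

open LieModule Module

variable {K L M : Type*} [Field K] [LieRing L] [LieAlgebra K L]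
  [AddCommGroup M] [Module K M] [LieRingModule L M] [LieModule K L M]
  {h e f : L}

lemma lie_h_pow_toEnd_e_add (t : IsSl2Triple h e f) {v w : M} {μ : K}
    (hv : ⁅h, v⁆ = μ • v + w) (k : ℕ) :
    ⁅h, (toEnd K L M e ^ k) v⁆ =
      (μ + 2 * k) • (toEnd K L M e ^ k) v + (toEnd K L M e ^ k) w := by
  induction k with
  | zero => simpa using hv
  | succ k ih =>
    simp only [pow_succ', Module.End.mul_apply, toEnd_apply_apply]
    rw [leibniz_lie h, t.lie_h_e_smul K, ih, smul_lie, lie_add, lie_smul]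
    push_cast
    module

lemma lie_h_pow_toEnd_f_add (t : IsSl2Triple h e f) {v w : M} {μ : K}
    (hv : ⁅h, v⁆ = μ • v + w) (k : ℕ) :
    ⁅h, (toEnd K L M f ^ k) v⁆ =
      (μ - 2 * k) • (toEnd K L M f ^ k) v + (toEnd K L M f ^ k) w := by
  induction k with
  | zero => simpa using hv
  | succ k ih =>
    simp only [pow_succ', Module.End.mul_apply, toEnd_apply_apply]
    rw [leibniz_lie h, t.lie_lie_smul_f K, ih, neg_lie, smul_lie, lie_add, lie_smul]
    push_cast
    module

lemma lie_e_pow_succ_toEnd_f_add (t : IsSl2Triple h e f) {v w : M} {μ : K}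
    (hv : ⁅h, v⁆ = μ • v + w) (hev : ⁅e, v⁆ = 0) (k : ℕ) :
    ⁅e, (toEnd K L M f ^ (k + 1)) v⁆ =
      ((k + 1 : K) * (μ - k)) • (toEnd K L M f ^ k) v +
        (k + 1 : K) • (toEnd K L M f ^ k) w := by
  induction k with
  | zero => simp [leibniz_lie e, t.lie_e_f, hv, hev]
  | succ k ih =>
    rw [pow_succ', Module.End.mul_apply, toEnd_apply_apply, leibniz_lie e, t.lie_e_f, ih,
      t.lie_h_pow_toEnd_f_add hv]
    simp only [pow_succ', Module.End.mul_apply, toEnd_apply_apply, lie_add, lie_smul]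
    push_cast
    module

/-- The Casimir operator `h² + 2h + 4fe` of an `sl₂` triple, acting on a module. -/
noncomputable def casimir (K M : Type*) [Field K] [AddCommGroup M] [Module K M] {L : Type*}
    [LieRing L] [LieAlgebra K L] [LieRingModule L M] [LieModule K L M] (h e f : L) : End K M :=
  toEnd K L M h ^ 2 + (2 : K) • toEnd K L M h + (4 : K) • (toEnd K L M f * toEnd K L M e)

lemma casimir_apply (m : M) :
    casimir K M h e f m = ⁅h, ⁅h, m⁆⁆ + (2 : K) • ⁅h, m⁆ + (4 : K) • ⁅f, ⁅e, m⁆⁆ := by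
  simp [casimir, pow_two]

lemma casimir_lie_e (t : IsSl2Triple h e f) (m : M) :
    casimir K M h e f ⁅e, m⁆ = ⁅e, casimir K M h e f m⁆ := by
  have h1 (m : M) : ⁅h, ⁅e, m⁆⁆ = (2 : K) • ⁅e, m⁆ + ⁅e, ⁅h, m⁆⁆ := by
    rw [leibniz_lie h, t.lie_h_e_smul K, smul_lie]
  have h2 (m : M) : ⁅e, ⁅f, m⁆⁆ = ⁅h, m⁆ + ⁅f, ⁅e, m⁆⁆ := by
    rw [leibniz_lie e, t.lie_e_f]
  simp only [casimir_apply, lie_add, lie_smul, h2, h1]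
  module

lemma casimir_lie_h (t : IsSl2Triple h e f) (m : M) :
    casimir K M h e f ⁅h, m⁆ = ⁅h, casimir K M h e f m⁆ := by
  have h1 (m : M) : ⁅h, ⁅e, m⁆⁆ = (2 : K) • ⁅e, m⁆ + ⁅e, ⁅h, m⁆⁆ := by
    rw [leibniz_lie h, t.lie_h_e_smul K, smul_lie]
  have h2 (m : M) : ⁅h, ⁅f, m⁆⁆ = -(2 : K) • ⁅f, m⁆ + ⁅f, ⁅h, m⁆⁆ := by
    rw [leibniz_lie h, t.lie_lie_smul_f K, neg_lie, smul_lie, neg_smul]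
  simp only [casimir_apply, lie_add, lie_smul, h2, h1]
  module

lemma casimir_of_lie_e_eq_zero {m : M} {μ : K} (hm : ⁅h, m⁆ = μ • m)
    (he : ⁅e, m⁆ = 0) : casimir K M h e f m = (μ * (μ + 2)) • m := by
  rw [casimir_apply, he, hm, lie_smul, hm, lie_zero]
  module

variable [CharZero K] [FiniteDimensional K M]

lemma exists_pow_toEnd_e_eq_zero (t : IsSl2Triple h e f) {m : M} {μ : K}
    (hm : ⁅h, m⁆ = μ • m) : ∃ k : ℕ, (toEnd K L M e ^ k) m = 0 := by
  by_contra! contra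
  have hinj : Function.Injective fun n : ℕ ↦ μ + 2 * (n : K) := fun a b hab ↦ by simpa using hab
  exact not_finite_iff_infinite.mpr inferInstance
    (((toEnd K L M h).eigenvectors_linearIndependent' (fun n : ℕ ↦ μ + 2 * (n : K)) hinj
      (fun n ↦ (toEnd K L M e ^ n) m) (fun n ↦ Module.End.hasEigenvector_iff.mpr
        ⟨by simpa [Module.End.mem_eigenspace_iff] using t.lie_h_pow_toEnd_e hm n,
          contra n⟩)).finite)

lemma exists_pow_toEnd_f_eq_zero (t : IsSl2Triple h e f) {m : M} {μ : K}
    (hm : ⁅h, m⁆ = μ • m) : ∃ k : ℕ, (toEnd K L M f ^ k) m = 0 :=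
  t.symm.exists_pow_toEnd_e_eq_zero (μ := -μ) (by simp [hm])

/-- If `h` had a nontrivial Jordan block `⟨w, v⟩` inside the kernel of `e`, then `f ^ j` applied
to `v` would be nonzero for every `j` beyond the highest weight. -/
lemma eq_zero_of_lie_h_eq_add_of_lie_e_eq_zero (t : IsSl2Triple h e f)
    {v w : M} {μ : K} (hv : ⁅h, v⁆ = μ • v + w) (hw : ⁅h, w⁆ = μ • w)
    (hev : ⁅e, v⁆ = 0) (hew : ⁅e, w⁆ = 0) : w = 0 := by
  by_contra hw0
  have P : t.HasPrimitiveVectorWith w μ := ⟨hw0, hw, hew⟩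
  obtain ⟨n, hn⟩ := P.exists_nat
  have hfw : (toEnd K L M f ^ (n + 1)) w = 0 := P.pow_toEnd_f_eq_zero_of_eq_nat hn
  have hfw' (j : ℕ) : (toEnd K L M f ^ (n + 1 + j)) w = 0 :=
    Module.End.pow_map_zero_of_le (Nat.le_add_right _ _) hfw
  -- Past the highest weight, `e` maps each `f ^ (n + 2 + j) v` to a nonzero multiple of the
  -- previous vector, since `f ^ (n + 1 + j) w = 0`; the first step uses `f ^ n w ≠ 0`.
  have key (j : ℕ) : (toEnd K L M f ^ (n + 1 + j)) v ≠ 0 := by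
    induction j with
    | zero =>
      intro h0
      have := t.lie_e_pow_succ_toEnd_f_add hv hev n
      rw [add_zero] at h0
      rw [h0, hn, sub_self, mul_zero, zero_smul, zero_add, lie_zero] at this
      exact (smul_ne_zero (Nat.cast_add_one_ne_zero n)
        (P.pow_toEnd_f_ne_zero_of_eq_nat hn le_rfl)) this.symm
    | succ j ih =>
      intro h0
      have := t.lie_e_pow_succ_toEnd_f_add hv hev (n + 1 + j)
      rw [show n + 1 + (j + 1) = n + 1 + j + 1 by ring] at h0
      rw [h0, hfw', smul_zero, add_zero, lie_zero] at this
      refine smul_ne_zero (mul_ne_zero (Nat.cast_add_one_ne_zero _) ?_) ih this.symm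
      rw [hn, sub_ne_zero]
      exact fun h ↦ absurd (Nat.cast_injective h) (by omega)
  obtain ⟨k, hk⟩ := t.exists_pow_toEnd_f_eq_zero (m := (toEnd K L M f ^ (n + 1)) v)
    (μ := μ - 2 * ((n + 1 : ℕ) : K)) (by rw [t.lie_h_pow_toEnd_f_add hv, hfw, add_zero])
  refine key k ?_
  rw [← hk, ← Module.End.mul_apply, ← pow_add, add_comm]

/-- A Jordan block `⟨w, v⟩` of `h` whose eigenvector `w` is killed by `e` is trivial. The proof
lowers the order of nilpotency of `e` on `v` by applying `C - c` to the block, where `C` is the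
Casimir operator and `c` the scalar by which it acts on `e ^ a v`. -/
lemma eq_zero_of_lie_h_eq_add_of_pow_e (t : IsSl2Triple h e f)
    {μ : K} (a : ℕ) {v w : M} (hv : ⁅h, v⁆ = μ • v + w) (hw : ⁅h, w⁆ = μ • w)
    (hev : (toEnd K L M e ^ (a + 1)) v = 0) (hew : ⁅e, w⁆ = 0) : w = 0 := by
  induction a generalizing v w with
  | zero => exact t.eq_zero_of_lie_h_eq_add_of_lie_e_eq_zero hv hw (by simpa using hev) hew
  | succ b ih =>
    by_contra hw0
    obtain ⟨n, hn⟩ := (⟨hw0, hw, hew⟩ : t.HasPrimitiveVectorWith w μ).exists_nat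
    -- `y` has weight `ν` and is killed by `e`, so the Casimir operator maps it to `ν * (ν + 2)`
    -- times itself.
    set ν : K := μ + 2 * ((b + 1 : ℕ) : K) with hν
    set y := (toEnd K L M e ^ (b + 1)) v with hy
    have hey : ⁅e, y⁆ = 0 := by
      rw [← toEnd_apply_apply K, hy, ← Module.End.mul_apply, ← pow_succ', hev]
    have hyh : ⁅h, y⁆ = ν • y := by
      rw [hy, t.lie_h_pow_toEnd_e_add hv]
      simp [pow_succ, hew, hν]
    have hcomm (k : ℕ) (m : M) : (toEnd K L M e ^ k) (casimir K M h e f m) =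
        casimir K M h e f ((toEnd K L M e ^ k) m) := by
      induction k with
      | zero => simp
      | succ k ih => simp [pow_succ', ih, t.casimir_lie_e]
    have hCw := casimir_of_lie_e_eq_zero (f := f) hw hew
    -- The block `(C - ν * (ν + 2)) ⟨w, v⟩` is killed by a smaller power of `e`.
    have := ih (v := casimir K M h e f v - (ν * (ν + 2)) • v)
      (w := (μ * (μ + 2) - ν * (ν + 2)) • w)
      (by rw [lie_sub, ← t.casimir_lie_h, lie_smul, hv, map_add, map_smul, hCw]; module)
      (by rw [lie_smul, hw, smul_comm])
      (by rw [map_sub, map_smul, hcomm, ← hy, casimir_of_lie_e_eq_zero hyh hey, sub_self])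
      (by rw [lie_smul, hew, smul_zero])
    refine hw0 ((smul_eq_zero.mp this).resolve_left ?_)
    -- The weight `μ = n` is a natural number, so the two Casimir values differ.
    have hne : ((2 * (b + 1) * (2 * n + 2 * b + 4) : ℕ) : K) ≠ 0 :=
      Nat.cast_ne_zero.mpr (by positivity)
    rw [hν, hn]
    intro h0
    apply hne
    push_cast at h0 ⊢
    linear_combination -h0

/-- The element `h` of an `sl₂` triple has no nontrivial Jordan block on a finite-dimensional
module. -/
lemma eq_zero_of_lie_h_eq_add (t : IsSl2Triple h e f)
    {v w : M} {μ : K} (hv : ⁅h, v⁆ = μ • v + w) (hw : ⁅h, w⁆ = μ • w) : w = 0 := by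
  by_contra hw0
  obtain ⟨k, hk, hk'⟩ := Nat.exists_not_and_succ_of_not_zero_of_exists
    (p := fun k ↦ (toEnd K L M e ^ k) w = 0) (by simpa using hw0) (t.exists_pow_toEnd_e_eq_zero hw)
  have hv' := t.lie_h_pow_toEnd_e_add hv (k + 1)
  rw [hk', add_zero] at hv'
  obtain ⟨j, hj⟩ := t.exists_pow_toEnd_e_eq_zero hv'
  -- `e ^ k` moves the block to one whose eigenvector is killed by `e`.
  refine hk (t.eq_zero_of_lie_h_eq_add_of_pow_e j (t.lie_h_pow_toEnd_e_add hv k)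
    (t.lie_h_pow_toEnd_e hw k) ?_ (by simpa [pow_succ'] using hk'))
  rw [← hj, ← Module.End.mul_apply, ← Module.End.mul_apply, ← pow_add, ← pow_add]
  congr 2
  ring

lemma exists_int_of_lie_h_eq_smul (t : IsSl2Triple h e f)
    {v : M} {μ : K} (hv : ⁅h, v⁆ = μ • v) (hv0 : v ≠ 0) : ∃ n : ℤ, μ = n := by
  obtain ⟨k, hk, hk'⟩ := Nat.exists_not_and_succ_of_not_zero_of_exists
    (p := fun k ↦ (toEnd K L M e ^ k) v = 0) (by simpa using hv0) (t.exists_pow_toEnd_e_eq_zero hv)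
  obtain ⟨n, hn⟩ := (⟨hk, t.lie_h_pow_toEnd_e hv k, by simpa [pow_succ'] using hk'⟩ :
    t.HasPrimitiveVectorWith _ _).exists_nat
  exact ⟨n - 2 * k, by push_cast; linear_combination hn⟩

lemma maxGenEigenspace_toEnd_h_eq_eigenspace (t : IsSl2Triple h e f)
    (μ : K) : (toEnd K L M h).maxGenEigenspace μ = (toEnd K L M h).eigenspace μ := by
  refine le_antisymm (fun v hv ↦ ?_) (((toEnd K L M h).genEigenspace μ).mono le_top)
  rw [Module.End.mem_maxGenEigenspace] at hv
  obtain ⟨k, hk⟩ := hv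
  induction k generalizing v with
  | zero => simp_all
  | succ k ih =>
    rw [pow_succ, Module.End.mul_apply] at hk
    have hw := Module.End.mem_eigenspace_iff.mp (ih _ hk)
    rw [show (toEnd K L M h - μ • 1) v = ⁅h, v⁆ - μ • v from rfl] at hw
    rw [toEnd_apply_apply] at hw
    rw [Module.End.mem_eigenspace_iff, toEnd_apply_apply, ← sub_eq_zero]
    exact t.eq_zero_of_lie_h_eq_add (by abel) hw

end IsSl2Triple

/-! ### Jordan decomposition in Killing Lie algebras -/

namespace LieAlgebra

open LieModule Module

section Cartan

variable {K L : Type*} [Field K] [Infinite K] [LieRing L] [LieAlgebra K L] [FiniteDimensional K L]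

/-- An `ad`-semisimple element `y` lies in a Cartan subalgebra. Any Cartan subalgebra of the
centralizer of `y` contains `y` and is also a Cartan subalgebra of `L`; the centralizer appears
here as the Engel subalgebra of `y`, with which it agrees because `ad y` is semisimple. -/
theorem exists_isCartanSubalgebra_mem_of_isSemisimple_ad {y : L} (hy : (ad K L y).IsSemisimple) :
    ∃ H : LieSubalgebra K L, H.IsCartanSubalgebra ∧ y ∈ H := by
  set C := LieSubalgebra.engel K y with hC
  have mem_C {z : L} : z ∈ C ↔ ⁅y, z⁆ = 0 := by
    change z ∈ (ad K L y).maxGenEigenspace 0 ↔ _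
    rw [hy.isFinitelySemisimple.maxGenEigenspace_eq_eigenspace]
    simp
  obtain ⟨x, hx⟩ := exists_isCartanSubalgebra_engel K C
  set H' := LieSubalgebra.engel K x
  have hyC : y ∈ C := LieSubalgebra.self_mem_engel K y
  have hyH : (⟨y, hyC⟩ : C) ∈ H' := by
    rw [LieSubalgebra.mem_engel_iff]
    refine ⟨1, Subtype.ext ?_⟩
    have := mem_C.mp x.2
    rw [← lie_skew, neg_eq_zero] at this
    simpa using this
  refine ⟨H'.map C.incl, ⟨?_, le_antisymm (fun z hz ↦ ?_) (LieSubalgebra.le_normalizer _)⟩,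
    ⟨_, hyH, rfl⟩⟩
  · exact (LieEquiv.nilpotent_iff_equiv_nilpotent
      (H'.equivMapOfInjective C.incl Subtype.val_injective)).mp hx.nilpotent
  · rw [LieSubalgebra.mem_normalizer_iff'] at hz
    -- An element normalizing the smaller subalgebra commutes with `y`, hence lies in `C`.
    have hzC : z ∈ C := by
      obtain ⟨w, -, hw⟩ := hz y ⟨_, hyH, rfl⟩
      have h2 : ⁅y, ⁅y, z⁆⁆ = 0 := mem_C.mp (hw ▸ w.2)
      rw [hC, LieSubalgebra.mem_engel_iff]
      exact ⟨2, by simpa [pow_two] using h2⟩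
    refine ⟨⟨z, hzC⟩, ?_, rfl⟩
    change _ ∈ H'
    rw [← hx.self_normalizing, LieSubalgebra.mem_normalizer_iff']
    intro w hw
    obtain ⟨u, hu, hu'⟩ := hz w ⟨w, hw, rfl⟩
    convert! hu using 1
    exact Subtype.ext hu'.symm

end Cartan

section Killing

variable {K L : Type*} [Field K] [LieRing L] [LieAlgebra K L] [FiniteDimensional K L]
  [IsKilling K L]

/-- A Lie algebra with non-degenerate Killing form is perfect, in dual form. -/
lemma IsKilling.eq_zero_of_forall_apply_lie_eq_zero (t : Dual K L) (ht : ∀ a b : L, t ⁅a, b⁆ = 0) :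
    t = 0 := by
  obtain ⟨y, rfl⟩ :=
    ((killingForm K L).toDual (IsKilling.killingForm_nondegenerate K L)).surjective t
  simp only [LinearMap.BilinForm.toDual_def] at ht
  have hy : ad K L y = 0 := by
    ext a
    have : killingForm K L ⁅y, a⁆ = 0 := by
      ext b
      rw [traceForm_apply_lie_apply, ht, LinearMap.zero_apply]
    have h := IsKilling.ker_killingForm_eq_bot K L
    exact (Submodule.eq_bot_iff _).mp h _ (LinearMap.mem_ker.mpr this)
  have : y = 0 := by
    rwa [← LieHom.mem_ker, ad_ker_eq_self_module_ker, self_module_ker_eq_center,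
      LieAlgebra.center_eq_bot, LieSubmodule.mem_bot] at hy
  simp [this]

variable [IsAlgClosed K]

variable (K) in
/-- Jordan decomposition inside `L`: the semisimple part of `ad x` is a derivation, because it
acts by the scalar `μ` on the generalized `μ`-eigenspace and these spaces are compatible with the
bracket; derivations of `L` are inner. -/
theorem IsKilling.exists_isSemisimple_ad_isNilpotent_ad (x : L) :
    ∃ s n : L, x = n + s ∧ ⁅s, x⁆ = 0 ∧ (ad K L s).IsSemisimple ∧ IsNilpotent (ad K L n) := by
  obtain ⟨N, -, S, hS, hN_nil, hS_ss, hNS⟩ := (ad K L x).exists_isNilpotent_isSemisimple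
  have hcomm : Commute (ad K L x) S :=
    Algebra.commute_of_mem_adjoin_self hS
  have hSμ {μ : K} {a : L} (ha : a ∈ (ad K L x).maxGenEigenspace μ) : S a = μ • a :=
    Module.End.apply_eq_of_mem_of_comm_of_isFinitelySemisimple_of_isNil ha hcomm
      hS_ss.isFinitelySemisimple (by rwa [hNS, add_sub_cancel_right])
  have htop := Module.End.iSup_maxGenEigenspace_eq_top (ad K L x)
  have hleib (a b : L) : S ⁅a, b⁆ = ⁅a, S b⁆ - ⁅b, S a⁆ := by
    induction htop ▸ Submodule.mem_top (x := a) using Submodule.iSup_induction' with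
    | zero => simp
    | add a a' _ _ ha ha' => simp only [add_lie, map_add, lie_add, ha, ha']; abel
    | mem μ a ha =>
      induction htop ▸ Submodule.mem_top (x := b) using Submodule.iSup_induction' with
      | zero => simp
      | add b b' _ _ hb hb' => simp only [add_lie, map_add, lie_add, hb, hb']; abel
      | mem ν b hb =>
        rw [hSμ (lie_mem_maxGenEigenspace_toEnd ha hb), hSμ ha, hSμ hb, lie_smul, lie_smul,
          ← lie_skew a b]
        module
  obtain ⟨s, hs⟩ := LieDerivation.IsKilling.exists_eq_ad (R := K) (⟨S, hleib⟩ : LieDerivation K L L)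
  have hs' : ad K L s = S := by
    ext a
    simpa using LieDerivation.congr_fun hs a
  refine ⟨s, x - s, by abel, ?_, hs' ▸ hS_ss, ?_⟩
  · rw [← ad_apply K, hs', hSμ (μ := 0) (LieSubalgebra.self_mem_engel K x), zero_smul]
  · rwa [map_sub, hs', hNS, add_sub_cancel_right]

/-- An `ad`-nilpotent element `n` acts nilpotently on every module: its generalized eigenspaces
are submodules, since `L` is the generalized `0`-eigenspace of `ad n`. On the one for `c` the trace
of `n` is `c` times the dimension, whereas it vanishes because `L` is perfect. -/
theorem IsKilling.isNilpotent_toEnd_of_isNilpotent_ad [CharZero K] {M : Type*} [AddCommGroup M]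
    [Module K M] [LieRingModule L M] [LieModule K L M] [FiniteDimensional K M] {n : L}
    (hn : IsNilpotent (ad K L n)) : IsNilpotent (toEnd K L M n) := by
  have hmem (y : L) : y ∈ (ad K L n).maxGenEigenspace 0 := by
    obtain ⟨k, hk⟩ := hn
    rw [Module.End.mem_maxGenEigenspace]
    exact ⟨k, by simp [hk]⟩
  have hbot (c : K) (hc : c ≠ 0) : (toEnd K L M n).maxGenEigenspace c = ⊥ := by
    let W : LieSubmodule K L M :=
      { (toEnd K L M n).maxGenEigenspace c with
        lie_mem := fun {y m} hm ↦ by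
          simpa using lie_mem_maxGenEigenspace_toEnd (hmem y) hm }
    have htr := LinearMap.congr_fun (IsKilling.eq_zero_of_forall_apply_lie_eq_zero
      (LinearMap.trace K W ∘ₗ (toEnd K L W : L →ₗ[K] End K W))
      (fun a b ↦ by simp [LieHom.map_lie])) n
    have hnil : IsNilpotent (toEnd K L W n - algebraMap K (End K W) c) := by
      have := (toEnd K L M n).isNilpotent_restrict_maxGenEigenspace_sub_algebraMap c
      exact this
    have h0 := (LinearMap.isNilpotent_trace_of_isNilpotent hnil).eq_zero
    have h1 : LinearMap.trace K W (toEnd K L W n) = 0 := htr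
    rw [map_sub, h1, zero_sub, neg_eq_zero, Algebra.algebraMap_eq_smul_one, map_smul,
      LinearMap.trace_one, smul_eq_mul, mul_eq_zero, Nat.cast_eq_zero] at h0
    exact Submodule.finrank_eq_zero.mp (h0.resolve_left hc)
  have htop := Module.End.iSup_maxGenEigenspace_eq_top (toEnd K L M n)
  have h0 : (toEnd K L M n).maxGenEigenspace 0 = ⊤ := by
    refine eq_top_iff.mpr (htop ▸ iSup_le fun c ↦ ?_)
    by_cases hc : c = 0
    · rw [hc]
    · simp [hbot c hc]
  refine (Module.End.isNilpotent_iff_of_finite).mpr fun m ↦ ?_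
  have := (Module.End.mem_maxGenEigenspace _ _ _).mp (h0 ▸ Submodule.mem_top (x := m))
  simpa only [zero_smul, sub_zero] using this

end Killing

section Split

variable {K L M : Type*} [Field K] [CharZero K] [IsAlgClosed K] [LieRing L] [LieAlgebra K L]
  [FiniteDimensional K L] [IsKilling K L] (H : LieSubalgebra K L) [H.IsCartanSubalgebra]
  [AddCommGroup M] [Module K M] [LieRingModule L M] [LieModule K L M] [FiniteDimensional K M]

open IsKilling in
variable (M) in
/-- The coroots act simultaneously diagonalizably, with integer eigenvalues, on every
finite-dimensional module. -/
theorem IsKilling.iSup_iInf_eigenspace_coroot_eq_top :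
    ⨆ χ : H.root → ℤ, ⨅ α : H.root, (toEnd K L M (coroot α.1 : L)).eigenspace (χ α : K) = ⊤ := by
  have key (α : H.root) : ∃ e f : L, IsSl2Triple (coroot α.1 : L) e f := by
    have hα : α.1.IsNonZero := LieSubalgebra.isNonZero_coe_root α
    obtain ⟨h, e, f, t, he, hf⟩ := exists_isSl2Triple_of_weight_isNonZero hα
    exact ⟨e, f, t.h_eq_coroot hα he hf ▸ t⟩
  choose e f t using key
  have := Module.End.iSup_iInf_maxGenEigenspace_eq_top_of_iSup_maxGenEigenspace_eq_top_of_commute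
    (fun α : H.root ↦ toEnd K L M (coroot α.1 : L))
    (fun α β _ ↦ by
      change Commute (toEnd K L M (coroot α.1 : L)) (toEnd K L M (coroot β.1 : L))
      rw [commute_iff_lie_eq, ← LieHom.map_lie, ← LieSubalgebra.coe_bracket, trivial_lie_zero]
      simp)
    (fun α ↦ Module.End.iSup_maxGenEigenspace_eq_top _)
  refine eq_top_iff.mpr (this ▸ iSup_le fun χ m hm ↦ ?_)
  by_cases hm0 : m = 0
  · simp [hm0]
  simp only [(t _).maxGenEigenspace_toEnd_h_eq_eigenspace, Submodule.mem_iInf] at hm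
  have hχ (α : H.root) : ∃ n : ℤ, χ α = n :=
    (t α).exists_int_of_lie_h_eq_smul (Module.End.mem_eigenspace_iff.mp (hm α)) hm0
  choose n hn using hχ
  exact Submodule.mem_iSup_of_mem n (Submodule.mem_iInf _ |>.mpr fun α ↦ hn α ▸ hm α)

variable {H}

variable (M) in
/-- Let `φ` be an additive map of the ground field and `s` an element of a Cartan subalgebra.
Some `s'` in `L` acts on `M` as the endomorphism obtained from `s` by applying `φ` to its
eigenvalues. If `s` is the combination of coroots with coefficients `c α`, then `s'` has
coefficients `φ (c α)`: additivity of `φ` suffices since the coroots have integer eigenvalues. -/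
theorem IsKilling.exists_iSup_eigenspace_inf_eigenspace_eq_top (φ : K →+ K) {s : L} (hs : s ∈ H) :
    ∃ s' : L, ⨆ μ : K, (toEnd K L M s).eigenspace μ ⊓ (toEnd K L M s').eigenspace (φ μ) = ⊤ := by
  have hspan : (⟨s, hs⟩ : H) ∈ Submodule.span K (Set.range (IsKilling.rootSystem H).coroot) := by
    rw [RootPairing.IsRootSystem.span_coroot_eq_top]
    trivial
  obtain ⟨c, hc⟩ := (Submodule.mem_span_range_iff_exists_fun K).mp hspan
  replace hc : ∑ α, c α • (IsKilling.coroot α.1 : L) = s := by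
    simpa using congrArg Subtype.val hc
  refine ⟨∑ α, φ (c α) • (IsKilling.coroot α.1 : L), eq_top_iff.mpr ?_⟩
  rw [← IsKilling.iSup_iInf_eigenspace_coroot_eq_top M H]
  refine iSup_le fun χ m hm ↦ ?_
  simp only [Submodule.mem_iInf, Module.End.mem_eigenspace_iff, toEnd_apply_apply] at hm
  refine Submodule.mem_iSup_of_mem (∑ α, χ α • c α) ⟨?_, ?_⟩
  · simp [← hc, hm, Finset.sum_smul, smul_smul, mul_comm]
  · have hφ (α : H.root) : φ (c α * χ α) = χ α * φ (c α) := by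
      rw [mul_comm, ← zsmul_eq_mul, map_zsmul, zsmul_eq_mul]
    simp [hm, hφ, Finset.sum_smul, smul_smul, mul_comm]

end Split

/-- Every element of `L` splits inside `L` into commuting parts acting nilpotently and
diagonalizably on `M`, and applying an additive map `φ` to the eigenvalues of the second again
gives the action of an element of `L`. -/
theorem IsKilling.exists_eq_add_and_iSup_eigenspace_inf_eigenspace_eq_top {K L M : Type*}
    [Field K] [CharZero K] [IsAlgClosed K]
    [LieRing L] [LieAlgebra K L] [FiniteDimensional K L] [IsKilling K L]
    [AddCommGroup M] [Module K M] [LieRingModule L M] [LieModule K L M] [FiniteDimensional K M]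
    (φ : K →+ K) (x : L) :
    ∃ s s' n : L, x = n + s ∧ Commute (toEnd K L M n) (toEnd K L M s) ∧
      IsNilpotent (toEnd K L M n) ∧
      ⨆ μ : K, (toEnd K L M s).eigenspace μ ⊓ (toEnd K L M s').eigenspace (φ μ) = ⊤ := by
  obtain ⟨s, n, rfl, hsx, hs, hn⟩ := IsKilling.exists_isSemisimple_ad_isNilpotent_ad K x
  obtain ⟨H, hH, hsH⟩ := exists_isCartanSubalgebra_mem_of_isSemisimple_ad hs
  obtain ⟨s', hs'⟩ := IsKilling.exists_iSup_eigenspace_inf_eigenspace_eq_top M φ hsH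
  refine ⟨s, s', n, rfl, ?_, IsKilling.isNilpotent_toEnd_of_isNilpotent_ad hn, hs'⟩
  rw [lie_add, lie_self, add_zero] at hsx
  rw [Commute.symm_iff, commute_iff_lie_eq, ← LieHom.map_lie, hsx, _root_.map_zero]

end LieAlgebra

open Module in
/-- Extending scalars along a field extension preserves non-degeneracy of the Killing form. -/
theorem LieAlgebra.IsKilling.baseChange {F : Type*} (K : Type*) {L : Type*} [Field F] [Field K]
    [Algebra F K] [LieRing L] [LieAlgebra F L] [FiniteDimensional F L] [LieAlgebra.IsKilling F L] :
    LieAlgebra.IsKilling K (K ⊗[F] L) where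
  killingCompl_top_eq_bot := by
    have hB : killingForm K (K ⊗[F] L) = (killingForm F L).baseChange K :=
      LieModule.traceForm_baseChange F L L K
    have hnd := LieAlgebra.IsKilling.killingForm_nondegenerate F L
    let b := finBasis F L
    let b' := (killingForm F L).dualBasis hnd b
    refine (LieSubmodule.eq_bot_iff _).mpr fun x hx ↦ ?_
    rw [LieIdeal.mem_killingCompl] at hx
    refine (b.baseChange K).ext_elem fun i ↦ ?_
    have h := hx (1 ⊗ₜ b' i) (LieSubmodule.mem_top _)
    rw [hB, ← (b.baseChange K).sum_repr x] at h
    simpa [b', LinearMap.BilinForm.apply_dualBasis_left, Algebra.smul_def] using h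

/-! ### Diagonalizable endomorphisms and functions of them -/

namespace Module.End

variable {K V : Type*} [Field K] [AddCommGroup V] [Module K V]

/-- A diagonalizable endomorphism is semisimple: it agrees with the semisimple part of its
Jordan–Chevalley decomposition on every eigenspace. -/
lemma isSemisimple_of_iSup_eigenspace_eq_top [PerfectField K] [FiniteDimensional K V]
    {f : End K V} (hf : ⨆ μ : K, f.eigenspace μ = ⊤) : f.IsSemisimple := by
  obtain ⟨n, -, s, hs, hn, hss, hfs⟩ := f.exists_isNilpotent_isSemisimple
  have hcomm : Commute f s := Algebra.commute_of_mem_adjoin_self hs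
  suffices f = s from this ▸ hss
  have : ⊤ ≤ LinearMap.eqLocus f s := hf ▸ iSup_le fun μ m hm ↦ by
    rw [LinearMap.mem_eqLocus, mem_eigenspace_iff.mp hm,
      apply_eq_of_mem_of_comm_of_isFinitelySemisimple_of_isNil hm hcomm hss.isFinitelySemisimple
        (by rwa [hfs, add_sub_cancel_right])]
  exact LinearMap.ext fun m ↦ this (Submodule.mem_top (x := m))

lemma exists_eq_of_hasEigenvalue_of_iSup_eq_top {ι : Type*} {f : End K V} {W : ι → Submodule K V}
    {c : ι → K} (hW : ∀ i, W i ≤ f.eigenspace (c i)) (htop : ⨆ i, W i = ⊤) {μ : K}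
    (hμ : f.HasEigenvalue μ) : ∃ i, μ = c i := by
  by_contra! h
  have hdisj := f.eigenspaces_iSupIndep μ
  have : ⨆ ν, ⨆ (_ : ν ≠ μ), f.eigenspace ν = ⊤ :=
    eq_top_iff.mpr (htop ▸ iSup_le fun i ↦ (hW i).trans
      (le_iSup₂_of_le (c i) (h i).symm le_rfl))
  rw [this, disjoint_top] at hdisj
  exact hμ hdisj

/-- The hypothesis says that `s` is diagonalizable and that `u` is `φ` applied to `s`; it follows
that `u` is any polynomial in `s` interpolating `φ` on the eigenvalues. -/
lemma eq_aeval_of_iSup_eigenspace_inf_eigenspace_eq_top {φ : K → K} {s u : End K V}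
    (h : ⨆ μ, s.eigenspace μ ⊓ u.eigenspace (φ μ) = ⊤) {q : Polynomial K}
    (hq : ∀ μ, s.HasEigenvalue μ → q.eval μ = φ μ) : u = Polynomial.aeval s q := by
  have : ⊤ ≤ LinearMap.eqLocus u (Polynomial.aeval s q) := h ▸ iSup_le fun μ m hm ↦ by
    by_cases hm0 : m = 0
    · simp [hm0]
    have hs : s.HasEigenvector μ m := ⟨hm.1, hm0⟩
    rw [LinearMap.mem_eqLocus, mem_eigenspace_iff.mp hm.2, aeval_apply_of_hasEigenvector hs,
      hq μ (hasEigenvalue_of_hasEigenvector hs)]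
  exact LinearMap.ext fun m ↦ this (Submodule.mem_top (x := m))

lemma iSup_eigenspace_eq_top_of_inf {φ : K → K} {s u : End K V}
    (h : ⨆ μ, s.eigenspace μ ⊓ u.eigenspace (φ μ) = ⊤) : ⨆ μ, s.eigenspace μ = ⊤ := by
  rw [eq_top_iff, ← h]
  exact iSup_mono fun _ ↦ inf_le_left

lemma eq_of_iSup_eigenspace_inf_eigenspace_eq_top [FiniteDimensional K V] {φ : K → K}
    {s u u' : End K V} (h : ⨆ μ, s.eigenspace μ ⊓ u.eigenspace (φ μ) = ⊤)
    (h' : ⨆ μ, s.eigenspace μ ⊓ u'.eigenspace (φ μ) = ⊤) : u = u' := by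
  obtain ⟨q, hq⟩ : ∃ q : Polynomial K, ∀ μ : s.Eigenvalues, q.eval (μ : K) = φ μ :=
    (Polynomial.exists_eval_eq_iff (fun μ : s.Eigenvalues ↦ (μ : K)) (fun μ ↦ φ μ)).mpr
      fun μ ν hμν ↦ congrArg φ hμν
  have hq' (μ : K) (hμ : s.HasEigenvalue μ) : q.eval μ = φ μ := hq ⟨μ, hμ⟩
  rw [eq_aeval_of_iSup_eigenspace_inf_eigenspace_eq_top h hq',
    eq_aeval_of_iSup_eigenspace_inf_eigenspace_eq_top h' hq']

lemma iSup_eigenspace_inf_eigenspace_eq_top_of_commute [FiniteDimensional K V]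
    {f g : End K V} (hfg : Commute f g) (hf : ⨆ μ, f.eigenspace μ = ⊤)
    (hg : ⨆ μ, g.eigenspace μ = ⊤) :
    ⨆ p : K × K, f.eigenspace p.1 ⊓ g.eigenspace p.2 = ⊤ := by
  rw [iSup_prod, eq_top_iff, ← hf]
  exact iSup_mono fun μ ↦ (Submodule.eq_iSup_inf_genEigenspace 1
    (mapsTo_genEigenspace_of_comm hfg μ 1) hg).le

end Module.End

/-! ### Additive Jordan decompositions of real endomorphisms -/

section Complexification

open Module Polynomial

variable {V : Type*} [AddCommGroup V] [Module ℝ V]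

lemma complexify_eq_baseChangeHom (T : End ℝ V) :
    complexify T = End.baseChangeHom ℝ ℂ V T := rfl

lemma complexify_injective : Function.Injective (complexify (V := V)) :=
  LinearMap.baseChangeHom_injective ℝ V ℂ

lemma complexify_add (S T : End ℝ V) : complexify (S + T) = complexify S + complexify T :=
  LinearMap.baseChange_add S T

lemma Commute.complexify {S T : End ℝ V} (h : Commute S T) :
    Commute (complexify S) (complexify T) :=
  h.map (End.baseChangeHom ℝ ℂ V)

lemma IsNilpotent.complexify {T : End ℝ V} (h : IsNilpotent T) : IsNilpotent (complexify T) :=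
  h.map (End.baseChangeHom ℝ ℂ V)

lemma complexify_aeval (T : End ℝ V) (p : ℝ[X]) :
    complexify (aeval T p) = aeval (complexify T) (p.map (algebraMap ℝ ℂ)) := by
  rw [aeval_map_algebraMap]
  exact (aeval_algHom_apply (End.baseChangeHom ℝ ℂ V) T p).symm

variable [FiniteDimensional ℝ V]

lemma Module.End.IsSemisimple.complexify {T : End ℝ V} (h : T.IsSemisimple) :
    (complexify T).IsSemisimple := by
  refine End.isSemisimple_of_squarefree_aeval_eq_zero
    (p := (minpoly ℝ T).map (algebraMap ℝ ℂ)) ?_ ?_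
  · exact ((PerfectField.separable_iff_squarefree.mpr h.minpoly_squarefree).map).squarefree
  · rw [← complexify_aeval, minpoly.aeval, complexify_eq_baseChangeHom, map_zero]

/-- On a finite set of complex numbers the real part is given by a polynomial with *real*
coefficients. -/
lemma exists_real_polynomial_eval_eq_re (s : Set ℂ) (hs : s.Finite) :
    ∃ q : ℝ[X], ∀ z ∈ s, (q.map (algebraMap ℝ ℂ)).eval z = z.re := by
  -- Interpolate on the closure of `s` under conjugation and take real parts of the coefficients.
  set t : Set ℂ := s ∪ (starRingEnd ℂ) '' s with ht
  have : Finite t := (hs.union (hs.image _)).to_subtype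
  obtain ⟨r, hr⟩ : ∃ r : ℂ[X], ∀ z : t, r.eval (z : ℂ) = (z : ℂ).re :=
    (exists_eval_eq_iff (fun z : t ↦ (z : ℂ)) (fun z ↦ ((z : ℂ).re : ℂ))).mpr
      fun z w hzw ↦ by simp only [hzw]
  refine ⟨∑ i ∈ Finset.range (r.natDegree + 1), C (r.coeff i).re * X ^ i, fun z hz ↦ ?_⟩
  have h1 := hr ⟨z, Or.inl hz⟩
  have h2 := congrArg (starRingEnd ℂ) (hr ⟨starRingEnd ℂ z, Or.inr ⟨z, hz, rfl⟩⟩)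
  simp only [eval_eq_sum_range, map_sum, map_mul, map_pow, Complex.conj_conj, Complex.conj_re,
    Complex.conj_ofReal] at h1 h2
  simp only [Polynomial.map_sum, Polynomial.map_mul, Polynomial.map_pow, map_C, map_X,
    eval_finsetSum, eval_mul, eval_C, eval_pow, eval_X, Complex.coe_algebraMap,
    Complex.re_eq_add_conj]
  rw [Complex.re_eq_add_conj] at h1 h2
  simp only [div_mul_eq_mul_div, add_mul, ← Finset.sum_div, Finset.sum_add_distrib, h1, h2]
  ring

namespace IsAddJordanDecomposition

variable {X E H N : End ℝ V}

/-- The hyperbolic component is obtained from the semisimple one, `E + H`, by replacing each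
eigenvalue by its real part. -/
lemma iSup_eigenspace_inf_eigenspace_eq_top (h : IsAddJordanDecomposition X E H N) :
    ⨆ μ : ℂ, (complexify (E + H)).eigenspace μ ⊓
      (complexify H).eigenspace (μ.re : ℂ) = ⊤ := by
  rw [eq_top_iff, ← End.iSup_eigenspace_inf_eigenspace_eq_top_of_commute h.commute_EH.complexify
    h.elliptic.1 h.hyperbolic.1]
  refine iSup_le fun ⟨a, b⟩ v hv ↦ ?_
  by_cases hv0 : v = 0
  · simp [hv0]
  have ha := h.elliptic.2 a (End.hasEigenvalue_of_hasEigenvector ⟨hv.1, hv0⟩)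
  have hb := h.hyperbolic.2 b (End.hasEigenvalue_of_hasEigenvector ⟨hv.2, hv0⟩)
  have hab : (((a + b).re : ℝ) : ℂ) = b := Complex.ext (by simp [ha]) (by simp [hb])
  refine Submodule.mem_iSup_of_mem (a + b) ⟨?_, ?_⟩
  · have h1 := End.mem_eigenspace_iff.mp hv.1
    have h2 := End.mem_eigenspace_iff.mp hv.2
    refine End.mem_eigenspace_iff.mpr ?_
    rw [complexify_add, LinearMap.add_apply, add_smul]
    exact congrArg₂ (· + ·) h1 h2
  · rw [hab]
    exact hv.2

/-- After complexification, `N` and `E + H` form the Jordan–Chevalley decomposition of `X`. -/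
lemma complexify_eq (h : IsAddJordanDecomposition X E H N) {n s : End ℂ (ℂ ⊗[ℝ] V)}
    (hX : complexify X = n + s) (hn : IsNilpotent n) (hs : ⨆ μ, s.eigenspace μ = ⊤)
    (hns : Commute n s) : complexify N = n ∧ complexify (E + H) = s := by
  refine End.isNilpotent_isSemisimple_unique h.nilpotent.complexify
    (End.isSemisimple_of_iSup_eigenspace_eq_top ?_) hn
    (End.isSemisimple_of_iSup_eigenspace_eq_top hs)
    (h.commute_EN.add_left h.commute_HN).symm.complexify hns ?_
  · exact End.iSup_eigenspace_eq_top_of_inf h.iSup_eigenspace_inf_eigenspace_eq_top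
  · rw [← complexify_add, add_comm, ← h.eq_add, hX]

lemma unique {E' H' N' : End ℝ V} (h : IsAddJordanDecomposition X E H N)
    (h' : IsAddJordanDecomposition X E' H' N') : E = E' ∧ H = H' ∧ N = N' := by
  obtain ⟨hN, hS⟩ := h.complexify_eq (n := complexify N') (s := complexify (E' + H'))
    (by rw [← complexify_add, add_comm, ← h'.eq_add]) h'.nilpotent.complexify
    (End.iSup_eigenspace_eq_top_of_inf h'.iSup_eigenspace_inf_eigenspace_eq_top)
    (h'.commute_EN.add_left h'.commute_HN).symm.complexify
  have htop := h'.iSup_eigenspace_inf_eigenspace_eq_top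
  rw [← hS] at htop
  have hH : H = H' := complexify_injective <| End.eq_of_iSup_eigenspace_inf_eigenspace_eq_top
    (K := ℂ) (φ := fun μ : ℂ ↦ (μ.re : ℂ)) h.iSup_eigenspace_inf_eigenspace_eq_top htop
  have hEH := complexify_injective hS
  subst hH
  exact ⟨add_right_cancel hEH, rfl, complexify_injective hN⟩

variable (X) in
/-- Every endomorphism of a finite-dimensional real space has an additive Jordan decomposition:
the hyperbolic component is `q(S)`, where `S` is the semisimple part and `q` is a real polynomial
that agrees with the real part on the eigenvalues of `S`. -/
theorem exists_of_finiteDimensional :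
    ∃ E H N : End ℝ V, IsAddJordanDecomposition X E H N := by
  obtain ⟨N, -, S, hS, hN, hss, hX⟩ := X.exists_isNilpotent_isSemisimple
  have hNS : Commute S N := by
    have : Commute X S := Algebra.commute_of_mem_adjoin_self hS
    rw [hX] at this
    simpa using (this.sub_left (Commute.refl S)).symm
  obtain ⟨q, hq⟩ := exists_real_polynomial_eval_eq_re {μ | (complexify S).HasEigenvalue μ}
    (complexify S).finite_hasEigenvalue
  set H := aeval S q with hH
  have hHS : Commute S H := Algebra.commute_of_mem_adjoin_self (aeval_mem_adjoin_singleton ℝ S)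
  have hHN : Commute H N := Algebra.commute_of_mem_adjoin_singleton_of_commute
    (aeval_mem_adjoin_singleton ℝ S) hNS.symm |>.symm
  have htop := hss.complexify.iSup_eigenspace_eq_top
  have hHμ (μ : ℂ) : (complexify S).eigenspace μ ≤ (complexify H).eigenspace (μ.re : ℂ) := by
    intro v hv
    by_cases hv0 : v = 0
    · simp [hv0]
    rw [End.mem_eigenspace_iff, hH, complexify_aeval,
      End.aeval_apply_of_hasEigenvector (μ := μ) ⟨hv, hv0⟩, hq]
    exact End.hasEigenvalue_of_hasEigenvector ⟨hv, hv0⟩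
  have hEμ (μ : ℂ) :
      (complexify S).eigenspace μ ≤ (complexify (S - H)).eigenspace (μ - μ.re : ℂ) := by
    intro v hv
    have := End.mem_eigenspace_iff.mp (hHμ μ hv)
    rw [End.mem_eigenspace_iff] at hv ⊢
    rw [sub_smul, ← hv, ← this, complexify_eq_baseChangeHom, map_sub]
    rfl
  exact ⟨S - H, H, N,
    { eq_add := by rw [hX]; abel
      commute_EH := hHS.sub_left (Commute.refl H)
      commute_EN := hNS.sub_left hHN
      commute_HN := hHN
      elliptic := ⟨eq_top_iff.mpr (htop ▸ iSup_le fun μ ↦ (hEμ μ).trans (le_iSup _ _)),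
        fun μ hμ ↦ by
          obtain ⟨ν, rfl⟩ := End.exists_eq_of_hasEigenvalue_of_iSup_eq_top hEμ htop hμ
          simp⟩
      hyperbolic := ⟨eq_top_iff.mpr (htop ▸ iSup_le fun μ ↦ (hHμ μ).trans (le_iSup _ _)),
        fun μ hμ ↦ by
          obtain ⟨ν, rfl⟩ := End.exists_eq_of_hasEigenvalue_of_iSup_eq_top hHμ htop hμ
          simp⟩
      nilpotent := hN }⟩

end IsAddJordanDecomposition

omit [FiniteDimensional ℝ V] in
/-- If the complexification of `T` is the action of an element of `ℂ ⊗ g`, then `T` belongs to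
`g`. -/
lemma mem_of_toEnd_eq_complexify {g : LieSubalgebra ℝ (End ℝ V)} {x : ℂ ⊗[ℝ] g} {T : End ℝ V}
    (h : LieModule.toEnd ℂ (ℂ ⊗[ℝ] g) (ℂ ⊗[ℝ] V) x = complexify T) : T ∈ g := by
  -- The real-part map `ℂ ⊗ W → W` carries `ℂ ⊗ g` to `g` and is compatible with the actions.
  let ρ (W : Type _) [AddCommGroup W] [Module ℝ W] : ℂ ⊗[ℝ] W →ₗ[ℝ] W :=
    TensorProduct.lid ℝ W ∘ₗ Complex.reLm.rTensor W
  have key (y : ℂ ⊗[ℝ] g) (v : V) : (ρ g y : End ℝ V) v = ρ V ⁅y, (1 : ℂ) ⊗ₜ[ℝ] v⁆ := by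
    induction y using TensorProduct.induction_on with
    | zero => simp
    | add y z hy hz => simp [hy, hz]
    | tmul z a => simp [ρ, LieAlgebra.ExtendScalars.bracket_tmul]
  have : (ρ g x : End ℝ V) = T := by
    ext v
    have hx : ⁅x, (1 : ℂ) ⊗ₜ[ℝ] v⁆ = complexify T (1 ⊗ₜ v) := LinearMap.congr_fun h _
    rw [key, hx]
    simp [ρ, complexify]
  exact this ▸ (ρ g x).2

end Complexification

theorem mainTheorem3 {V : Type*} [AddCommGroup V] [Module ℝ V] [FiniteDimensional ℝ V]
    (g : LieSubalgebra ℝ (Module.End ℝ V)) (hg : LieAlgebra.HasTrivialRadical ℝ g)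
    (X : Module.End ℝ V) (hX : X ∈ g) :
    (∃! p : Module.End ℝ V × Module.End ℝ V × Module.End ℝ V,
      IsAddJordanDecomposition X p.1 p.2.1 p.2.2) ∧
    ∀ E H N : Module.End ℝ V, IsAddJordanDecomposition X E H N → E ∈ g ∧ H ∈ g ∧ N ∈ g := by
  constructor
  · obtain ⟨E, H, N, h⟩ := IsAddJordanDecomposition.exists_of_finiteDimensional X
    refine ⟨(E, H, N), h, fun p hp ↦ ?_⟩
    obtain ⟨h1, h2, h3⟩ := hp.unique h
    exact Prod.ext h1 (Prod.ext h2 h3)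
  · intro E H N h
    -- By Cartan's criterion, a trivial radical makes the Killing form of `g` non-degenerate.
    have := LieAlgebra.IsKilling.baseChange (F := ℝ) ℂ (L := g)
    obtain ⟨s, s', n, hx, hns, hn, hs⟩ :=
      LieAlgebra.IsKilling.exists_eq_add_and_iSup_eigenspace_inf_eigenspace_eq_top
      (M := ℂ ⊗[ℝ] V) (Complex.ofRealHom.toAddMonoidHom.comp Complex.reAddGroupHom)
      ((1 : ℂ) ⊗ₜ[ℝ] (⟨X, hX⟩ : g))
    have hX' : complexify X = LieModule.toEnd ℂ (ℂ ⊗[ℝ] g) (ℂ ⊗[ℝ] V) n +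
        LieModule.toEnd ℂ (ℂ ⊗[ℝ] g) (ℂ ⊗[ℝ] V) s := by
      rw [← map_add, ← hx, LieModule.toEnd_baseChange]
      rfl
    obtain ⟨hN, hS⟩ := h.complexify_eq hX' hn
      (Module.End.iSup_eigenspace_eq_top_of_inf hs) hns
    have htop := h.iSup_eigenspace_inf_eigenspace_eq_top
    rw [hS] at htop
    have hH := Module.End.eq_of_iSup_eigenspace_inf_eigenspace_eq_top
      (K := ℂ) (φ := fun μ : ℂ ↦ (μ.re : ℂ)) hs htop
    have hHg : H ∈ g := mem_of_toEnd_eq_complexify hH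
    have hNg : N ∈ g := mem_of_toEnd_eq_complexify hN.symm
    refine ⟨?_, hHg, hNg⟩
    have hE : E = X - H - N := by rw [h.eq_add]; abel
    rw [hE]
    exact sub_mem (sub_mem hX hHg) hNg
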